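/- Let $\Theta\subseteq\mathbb R^p$ and let $\{F(\cdot,\theta):\theta\in\Theta\}$ be a family of distribution functions on $\mathbb R$. Let $\theta^*\in\Theta$ be such that $F(\cdot,\theta^*)$ is continuous and $\theta^*$ is identified by its distribution, in the sense that for every sequence $(\theta_j)$ in $\Theta$, if $F(y,\theta_j)\to F(y,\theta^*)$ for all $y\in\mathbb R$, then $\theta_j\to\theta^*$. Let $\alpha_n,\beta_n$ be real numbers with $0<\alpha_n<\beta_n<1$ for all large $n$, $$\frac{\min\{\alpha_n,1-\beta_n\}}{\sqrt{\log n/n}}\to\infty,\qquad \alpha_n\to 0,\qquad \beta_n\to 1$$ (for example $\alpha_n=\sqrt{\log n\,\log\log n/n}$, $\beta_n=1-\alpha_n$), and let $\Lambda=\Lambda_n=\{i\in\{1,\dots,n\}:\alpha_n n<i<\beta_n n\}$. For each $n$ let $X_{(1)}\le\dots\le X_{(n)}$ be the order statistics of an i.i.d. sample from the unit exponential distribution, with distribution function $G(x)=1-e^{-x}$, and let $Y_{(1)}\le\dots\le Y_{(n)}$ be the order statistics of an i.i.d. sample of size $n$ from $P(Y\le y)=F(y,\theta^*)$. With $g(a,b)=\max\{a,b,1/a,1/b\}$,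 let $$L_n(\theta)=g\left(\max_{k\in\Lambda}\frac{X_{(k)}}{G^{-1}(F(Y_{(k)},\theta))},\ \max_{k\in\Lambda}\frac{G^{-1}(F(Y_{(k)},\theta))}{X_{(k)}}\right)\in[0,\infty],\qquad G^{-1}(1)=\infty .$$ Let $\widehat\theta_n\in\Theta$ be an estimator that, with probability tending to $1$, is a global minimizer of $L_n$ over $\Theta$. Then $\widehat\theta_n$ is a consistent estimator of $\theta^*$: $\widehat\theta_n\to\theta^*$ in probability as $n\to\infty$. -/

import Mathlib

open MeasureTheory ProbabilityTheory Filter Topology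
open scoped ENNReal

noncomputable section

/-- The `k`-th smallest entry of `x`; `k : Fin n` counts from `0`, so this is `x_{(k+1)}`. -/
def orderStat {n : ℕ} (x : Fin n → ℝ) (k : Fin n) : ℝ :=
  x (Tuple.sort x k)

/-- The inverse `G⁻¹` of the unit exponential distribution function `G(x) = 1 - e^{-x}` on `[0,1]`,
with `G⁻¹(1) = ∞`. -/
def expQuantile (u : ℝ) : ℝ≥0∞ :=
  if u < 1 then ENNReal.ofReal (-Real.log (1 - u)) else ⊤

/-- The middle indices `Λ = {i : a n < i < b n}`, where `i = k + 1` for `k : Fin n`. -/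
def middleIndices (n : ℕ) (a b : ℝ) : Finset (Fin n) :=
  {k : Fin n | a * n < (k : ℝ) + 1 ∧ (k : ℝ) + 1 < b * n}

/-- The truncation levels `α`, `β` satisfy `0 < α_n < β_n < 1` (for large `n`), and both
`α_n` and `1 - β_n` are of larger order than `√(log n / n)`. -/
def MiddleCondition (α β : ℕ → ℝ) : Prop :=
  (∀ᶠ n in atTop, 0 < α n ∧ α n < β n ∧ β n < 1) ∧
    Tendsto (fun n : ℕ => min (α n) (1 - β n) / Real.sqrt (Real.log n / n)) atTop atTop

/-- The maximum ranked quotient `max_{k ∈ Λ} u_k / v_k` of two ordered samples. -/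
def maxQuotient {n : ℕ} (Λ : Finset (Fin n)) (u v : Fin n → ℝ≥0∞) : ℝ≥0∞ :=
  Λ.sup fun k => u k / v k

/-- `g(a, b) = max {a, b, 1/a, 1/b}`. -/
def gMax (a b : ℝ≥0∞) : ℝ≥0∞ :=
  max (max a b) (max (1 / a) (1 / b))

/-- The objective function at the distribution function `F`: `g` applied to the two maximum ranked
quotients between `X_{(k)}` and `G⁻¹(F(Y_{(k)}))`, with values in `[0, ∞]`. -/
def nseLoss {n : ℕ} (Λ : Finset (Fin n)) (F : ℝ → ℝ) (x y : Fin n → ℝ) : ℝ≥0∞ :=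
  gMax
    (maxQuotient Λ (fun k => ENNReal.ofReal (orderStat x k))
      (fun k => expQuantile (F (orderStat y k))))
    (maxQuotient Λ (fun k => expQuantile (F (orderStat y k)))
      (fun k => ENNReal.ofReal (orderStat x k)))

/-- `t` is an NSE estimate, i.e. a global minimizer over `Θ` of the objective function
for the model `P` with distribution functions `F(·, θ) = cdf (P θ)`. -/
def IsNSE {Θ : Type*} {n : ℕ} (P : Θ → Measure ℝ) (Λ : Finset (Fin n)) (x y : Fin n → ℝ)
    (t : Θ) : Prop :=
  ∀ θ : Θ, nseLoss Λ (cdf (P t)) x y ≤ nseLoss Λ (cdf (P θ)) x y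

/-- The parameter is identified at `θ₀` by the distribution: `F(·, θ_j) → F(·, θ₀)` forces
`θ_j → θ₀`. In particular `F(·, θ) = F(·, θ₀)` only for `θ = θ₀`. -/
def IdentifiableAt {Θ : Type*} [TopologicalSpace Θ] (P : Θ → Measure ℝ) (θ₀ : Θ) : Prop :=
  ∀ t : ℕ → Θ,
    (∀ y : ℝ, Tendsto (fun j => cdf (P (t j)) y) atTop (𝓝 (cdf (P θ₀) y))) →
      Tendsto t atTop (𝓝 θ₀)

end

/-! ### Order statistics and counts -/

/-! Put δ = √(log n / n). Hoeffding's inequality and a union bound put `G(X_(k))` and `F(Y_(k), θ*)`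
within δ of k/n for all k ∈ Λ at once, except with probability at most 2/n for each sample
(`measureReal_exists_cdf_orderStat_le`). Since δ is negligible against α and 1 - β, this absolute
error becomes a relative error at most ε after applying G⁻¹ (`neg_log_one_sub_le`), so the loss at
θ* is at most 1 + ε.

A minimizer then also has loss at most 1 + ε, and this gives back an absolute bound: `F(Y_(k),
θhat)` is within ε of `G(X_(k))` (`abs_sub_le_of_nseLoss_le`). Monotonicity extends closeness at the
middle order statistics to closeness on the whole line (`abs_sub_le_of_middleIndices`), and
identifiability converts it into closeness of parameters. -/

lemma orderStat_le_iff {n : ℕ} (x : Fin n → ℝ) (k : Fin n) (a : ℝ) :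
    orderStat x k ≤ a ↔ (k : ℕ) < (Finset.univ.filter fun i => x i ≤ a).card := by
  have h := Tuple.lt_card_le_iff_apply_le_of_monotone (f := x ∘ Tuple.sort x) (j := k) (a := a)
    (Tuple.monotone_sort x)
  have hc : (Finset.univ.filter fun i => (x ∘ Tuple.sort x) i ≤ a).card
      = (Finset.univ.filter fun i => x i ≤ a).card :=
    Finset.card_equiv (Tuple.sort x) (by simp)
  rw [hc] at h
  exact h.symm

/-! ### Concentration of the counts -/

lemma exists_cdf_eq {ν : Measure ℝ} (hc : Continuous (cdf ν)) {t : ℝ} (h0 : 0 < t) (h1 : t < 1) :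
    ∃ y, cdf ν y = t := by
  obtain ⟨a, ha⟩ := ((tendsto_cdf_atBot ν).eventually (gt_mem_nhds h0)).exists
  obtain ⟨b, hb⟩ := ((tendsto_cdf_atTop ν).eventually (lt_mem_nhds h1)).exists
  exact mem_range_of_exists_le_of_exists_ge hc ⟨a, ha.le⟩ ⟨b, hb.le⟩

section Concentration

variable {Ω : Type*} [MeasurableSpace Ω] {μ : Measure Ω} [IsProbabilityMeasure μ]
  {ν : Measure ℝ} {n : ℕ} {Z : Fin n → Ω → ℝ}

/-- Hoeffding's inequality for the values of a bounded function along an i.i.d. sample. -/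
lemma measureReal_sum_sub_integral_ge_le (hlaw : ∀ i, HasLaw (Z i) ν μ) (hind : iIndepFun Z μ)
    {f : ℝ → ℝ} (hf : Measurable f) {a : ℝ} (hfa : ∀ z, f z ∈ Set.Icc a (a + 1)) {ε : ℝ}
    (hε : 0 ≤ ε) :
    μ.real {ω | ε ≤ ∑ i, (f (Z i ω) - ∫ z, f z ∂ν)} ≤ Real.exp (-2 * ε ^ 2 / n) := by
  have hsub : ∀ i ∈ (Finset.univ : Finset (Fin n)),
      HasSubgaussianMGF (fun ω => f (Z i ω) - ∫ z, f z ∂ν) ((‖(a + 1) - a‖₊ / 2) ^ 2) μ := by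
    intro i _
    have h := hasSubgaussianMGF_of_mem_Icc (μ := μ) (X := fun ω => f (Z i ω))
      (hf.comp_aemeasurable (hlaw i).aemeasurable) (ae_of_all _ fun ω => hfa (Z i ω))
    have he : ∫ ω, f (Z i ω) ∂μ = ∫ z, f z ∂ν :=
      (hlaw i).integral_comp hf.aestronglyMeasurable
    rwa [he] at h
  have hi : iIndepFun (fun i ω => f (Z i ω) - ∫ z, f z ∂ν) μ :=
    hind.comp (fun _ z => f z - ∫ z, f z ∂ν) fun _ => hf.sub_const _
  refine (HasSubgaussianMGF.measure_sum_ge_le_of_iIndepFun hi hsub hε).trans_eq ?_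
  congr 1
  simp only [add_sub_cancel_left, nnnorm_one, Finset.sum_const, Finset.card_univ,
    Fintype.card_fin]
  push_cast
  rcases Nat.eq_zero_or_pos n with rfl | hn
  · simp
  · simp only [nsmul_eq_mul]
    field_simp

variable [IsProbabilityMeasure ν]

lemma sum_indicator_eq_card {n : ℕ} (x : Fin n → ℝ) (y : ℝ) :
    ∑ i, (Set.Iic y).indicator (1 : ℝ → ℝ) (x i)
      = ((Finset.univ.filter fun i => x i ≤ y).card : ℝ) := by
  simp [Set.indicator_apply]

lemma measureReal_card_ge_le (hlaw : ∀ i, HasLaw (Z i) ν μ) (hind : iIndepFun Z μ) (y : ℝ)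
    {ε : ℝ} (hε : 0 ≤ ε) :
    μ.real {ω | n * cdf ν y + ε ≤ ((Finset.univ.filter fun i => Z i ω ≤ y).card : ℝ)}
      ≤ Real.exp (-2 * ε ^ 2 / n) := by
  have h := measureReal_sum_sub_integral_ge_le hlaw hind
    (f := (Set.Iic y).indicator 1) (measurable_one.indicator measurableSet_Iic) (a := 0)
    (fun z => by by_cases hz : z ≤ y <;> simp [hz]) hε
  convert h using 3
  ext ω
  rw [Finset.sum_sub_distrib, sum_indicator_eq_card, integral_indicator_one measurableSet_Iic,
    ← cdf_eq_real]
  simp only [Finset.sum_const, Finset.card_univ, Fintype.card_fin, nsmul_eq_mul]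
  constructor <;> intro h <;> linarith

lemma measureReal_card_le_le (hlaw : ∀ i, HasLaw (Z i) ν μ) (hind : iIndepFun Z μ) (y : ℝ)
    {ε : ℝ} (hε : 0 ≤ ε) :
    μ.real {ω | ((Finset.univ.filter fun i => Z i ω ≤ y).card : ℝ) ≤ n * cdf ν y - ε}
      ≤ Real.exp (-2 * ε ^ 2 / n) := by
  have h := measureReal_sum_sub_integral_ge_le hlaw hind
    (f := fun z => -(Set.Iic y).indicator 1 z)
    (measurable_one.indicator measurableSet_Iic).neg (a := -1)
    (fun z => by by_cases hz : z ≤ y <;> simp [hz]) hε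
  convert h using 3
  ext ω
  rw [Finset.sum_sub_distrib, Finset.sum_neg_distrib, sum_indicator_eq_card, integral_neg,
    integral_indicator_one measurableSet_Iic, ← cdf_eq_real]
  simp only [Finset.sum_const, Finset.card_univ, Fintype.card_fin, nsmul_eq_mul]
  constructor <;> intro h <;> linarith

/-- Continuity supplies points a, b where the distribution function equals (k+1)/n ∓ δ. The order
statistic exceeds b only if at most k sample points are ≤ b, while n(k+1)/n + nδ are expected;
symmetrically at a. Each event is a deviation of a count by at least nδ. -/
lemma measureReal_cdf_orderStat_le (hlaw : ∀ i, HasLaw (Z i) ν μ) (hind : iIndepFun Z μ)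
    (hc : Continuous (cdf ν)) (k : Fin n) {δ : ℝ} (hδ : 0 ≤ δ)
    (h0 : 0 < ((k : ℝ) + 1) / n - δ) (h1 : ((k : ℝ) + 1) / n + δ < 1) :
    μ.real {ω | δ < |cdf ν (orderStat (fun i => Z i ω) k) - ((k : ℝ) + 1) / n|}
      ≤ 2 * Real.exp (-2 * n * δ ^ 2) := by
  have hn : (0 : ℝ) < n := by exact_mod_cast k.pos
  obtain ⟨a, ha⟩ := exists_cdf_eq hc h0 (by linarith)
  obtain ⟨b, hb⟩ := exists_cdf_eq hc (by linarith) h1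
  have hA := measureReal_card_ge_le hlaw hind a (ε := n * δ) (by positivity)
  have hB := measureReal_card_le_le hlaw hind b (ε := n * δ) (by positivity)
  have he : -2 * (n * δ) ^ 2 / n = -2 * n * δ ^ 2 := by field_simp
  rw [he] at hA hB
  rw [two_mul]
  refine le_trans (measureReal_mono ?_) ((measureReal_union_le _ _).trans (add_le_add hA hB))
  intro ω hω
  rw [Set.mem_ofPred_eq, lt_abs] at hω
  have hk : (n : ℝ) * (((k : ℝ) + 1) / n) = k + 1 := by field_simp
  rcases hω with h | h
  · right
    rw [Set.mem_ofPred_eq, hb, mul_add, hk]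
    have : ¬ orderStat (fun i => Z i ω) k ≤ b := fun hle => by
      have := monotone_cdf ν hle
      linarith
    rw [orderStat_le_iff, not_lt] at this
    have : ((Finset.univ.filter fun i => Z i ω ≤ b).card : ℝ) ≤ k := by exact_mod_cast this
    linarith
  · left
    rw [Set.mem_ofPred_eq, ha, mul_sub, hk]
    have : orderStat (fun i => Z i ω) k ≤ a := by
      by_contra hle
      have := monotone_cdf ν (not_le.mp hle).le
      linarith
    rw [orderStat_le_iff] at this
    have : ((k : ℝ) + 1) ≤ (Finset.univ.filter fun i => Z i ω ≤ a).card := by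
      exact_mod_cast this
    linarith

lemma measureReal_exists_cdf_orderStat_le (hlaw : ∀ i, HasLaw (Z i) ν μ) (hind : iIndepFun Z μ)
    (hc : Continuous (cdf ν)) (Λ : Finset (Fin n)) {δ : ℝ} (hδ : 0 ≤ δ)
    (hΛ : ∀ k ∈ Λ, 0 < ((k : ℝ) + 1) / n - δ ∧ ((k : ℝ) + 1) / n + δ < 1) :
    μ.real {ω | ∃ k ∈ Λ, δ < |cdf ν (orderStat (fun i => Z i ω) k) - ((k : ℝ) + 1) / n|}
      ≤ n * (2 * Real.exp (-2 * n * δ ^ 2)) := by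
  have hset : {ω | ∃ k ∈ Λ, δ < |cdf ν (orderStat (fun i => Z i ω) k) - ((k : ℝ) + 1) / n|}
      = ⋃ k ∈ Λ, {ω | δ < |cdf ν (orderStat (fun i => Z i ω) k) - ((k : ℝ) + 1) / n|} := by
    ext ω
    simp
  rw [hset]
  refine (measureReal_biUnion_finset_le _ _).trans ?_
  refine (Finset.sum_le_card_nsmul _ _ _ fun k hk =>
    measureReal_cdf_orderStat_le hlaw hind hc k hδ (hΛ k hk).1 (hΛ k hk).2).trans ?_
  rw [nsmul_eq_mul]
  gcongr
  exact (Finset.card_le_univ Λ).trans_eq (Fintype.card_fin n)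

end Concentration

/-! ### The exponential quantile transform -/

lemma cdf_expMeasure_one (x : ℝ) :
    cdf (expMeasure 1) x = if 0 ≤ x then 1 - Real.exp (-x) else 0 := by
  simpa using cdf_expMeasure_eq one_pos x

lemma continuous_cdf_expMeasure_one : Continuous (cdf (expMeasure 1)) := by
  have h : (cdf (expMeasure 1) : ℝ → ℝ) = fun x => 1 - Real.exp (-max x 0) := by
    ext x
    rw [cdf_expMeasure_one]
    split_ifs with hx
    · rw [max_eq_left hx]
    · rw [max_eq_right (not_le.mp hx).le]
      simp
  rw [h]
  fun_prop

lemma eq_neg_log_of_cdf_expMeasure_pos {x : ℝ} (h : 0 < cdf (expMeasure 1) x) :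
    0 < x ∧ x = -Real.log (1 - cdf (expMeasure 1) x) := by
  rw [cdf_expMeasure_one] at h ⊢
  split_ifs at h ⊢ with hx
  · refine ⟨?_, by simp⟩
    have : Real.exp (-x) < 1 := by linarith
    rw [Real.exp_lt_one_iff] at this
    linarith
  · exact absurd h (lt_irrefl _)

/-- The logarithms differ by at most (u - v)/(1 - u) ≤ 2δ/(1 - u), and -log(1 - v) ≥ v, so 2δ ≤ ε
v(1 - u) suffices. The constant 8 comes from v(1 - u) ≥ D/4. -/
lemma neg_log_one_sub_le {u v δ D ε : ℝ} (hD : 0 < D) (hε : 0 < ε) (hδ : δ ≤ 1 / 4)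
    (hDε : 8 * δ ≤ ε * D) (hv : D ≤ v) (hv1 : v < 1)
    (hu : D ≤ 1 - u) (huv : u - v ≤ 2 * δ) :
    -Real.log (1 - u) ≤ (1 + ε) * -Real.log (1 - v) := by
  have hlv : v ≤ -Real.log (1 - v) := by
    have := Real.log_le_sub_one_of_pos (x := 1 - v) (by linarith)
    linarith
  have hlog : Real.log (1 - v) - Real.log (1 - u) ≤ (u - v) / (1 - u) := by
    rw [← Real.log_div (by linarith) (by linarith)]
    refine (Real.log_le_sub_one_of_pos (div_pos (by linarith) (by linarith))).trans_eq ?_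
    have : 1 - u ≠ 0 := by linarith
    field_simp
    ring
  -- One factor is at least 1/4, because v ≤ 1/4 forces u ≤ 3/4; the other is at least D.
  have hprod : D / 4 ≤ v * (1 - u) := by
    rcases le_total (1 / 4) v with h | h
    · nlinarith
    · have : 1 / 4 ≤ 1 - u := by linarith
      nlinarith
  have hquot : (u - v) / (1 - u) ≤ ε * v := by
    rw [div_le_iff₀ (by linarith)]
    nlinarith
  nlinarith

lemma gMax_le_iff {a b c : ℝ≥0∞} : gMax a b ≤ c ↔ (a ≤ c ∧ b ≤ c) ∧ 1 / a ≤ c ∧ 1 / b ≤ c := by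
  simp [gMax]

lemma maxQuotient_le_iff {n : ℕ} {Λ : Finset (Fin n)} {u v : Fin n → ℝ≥0∞} {c : ℝ≥0∞} :
    maxQuotient Λ u v ≤ c ↔ ∀ k ∈ Λ, u k / v k ≤ c := by
  simp [maxQuotient]

lemma le_maxQuotient {n : ℕ} {Λ : Finset (Fin n)} {u v : Fin n → ℝ≥0∞} {k : Fin n}
    (hk : k ∈ Λ) : u k / v k ≤ maxQuotient Λ u v :=
  Finset.le_sup (f := fun k => u k / v k) hk

lemma nseLoss_le {n : ℕ} {Λ : Finset (Fin n)} (hΛ : Λ.Nonempty) {F : ℝ → ℝ} {x y : Fin n → ℝ}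
    {c : ℝ} (h : ∀ k ∈ Λ, ∃ q, 0 < q ∧ 0 < orderStat x k ∧
      expQuantile (F (orderStat y k)) = ENNReal.ofReal q ∧
      orderStat x k ≤ c * q ∧ q ≤ c * orderStat x k) :
    nseLoss Λ F x y ≤ ENNReal.ofReal c := by
  have h1 : ∀ k ∈ Λ, ENNReal.ofReal (orderStat x k) / expQuantile (F (orderStat y k))
      ≤ ENNReal.ofReal c ∧ expQuantile (F (orderStat y k)) / ENNReal.ofReal (orderStat x k)
      ≤ ENNReal.ofReal c := by
    intro k hk
    obtain ⟨q, hq, hx, he, hxq, hqx⟩ := h k hk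
    rw [he, ← ENNReal.ofReal_div_of_pos hq, ← ENNReal.ofReal_div_of_pos hx]
    exact ⟨ENNReal.ofReal_le_ofReal ((div_le_iff₀ hq).2 hxq),
      ENNReal.ofReal_le_ofReal ((div_le_iff₀ hx).2 hqx)⟩
  obtain ⟨k, hk⟩ := hΛ
  obtain ⟨q, hq, hx, he, -, -⟩ := h k hk
  have hinv : ∀ a b : ℝ, 0 < b → 1 / (ENNReal.ofReal a / ENNReal.ofReal b)
      = ENNReal.ofReal b / ENNReal.ofReal a := fun a b hb => by
    rw [one_div, ENNReal.inv_div (.inl ENNReal.ofReal_ne_top)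
      (.inl (ENNReal.ofReal_pos.2 hb).ne')]
  refine gMax_le_iff.2 ⟨⟨maxQuotient_le_iff.2 fun k hk => (h1 k hk).1,
    maxQuotient_le_iff.2 fun k hk => (h1 k hk).2⟩, ?_, ?_⟩
  -- The reciprocal of a maximum is at most the reciprocal of any one quotient, which is a quotient
  -- of the other kind. For empty Λ it would be 1/0 = ∞.
  · refine (ENNReal.div_le_div_left (le_maxQuotient hk) 1).trans ?_
    rw [he, hinv _ _ hq, ← he]
    exact (h1 k hk).2
  · refine (ENNReal.div_le_div_left (le_maxQuotient hk) 1).trans ?_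
    rw [he, hinv _ _ hx, ← he]
    exact (h1 k hk).1

/-- A relative error in the quantile costs at most ε x e^{-x} in probability, and x e^{-x} ≤ 1
uniformly in x. -/
lemma exp_neg_sub_exp_neg_le {x q ε : ℝ} (hε : 0 ≤ ε) (hq : q ≤ (1 + ε) * x) :
    Real.exp (-x) - Real.exp (-q) ≤ ε := by
  have h1 : Real.exp (-q) ≥ Real.exp (-x) * (1 - ε * x) := by
    have := Real.add_one_le_exp (-(ε * x))
    calc Real.exp (-x) * (1 - ε * x) ≤ Real.exp (-x) * Real.exp (-(ε * x)) := by
          gcongr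
          linarith
      _ = Real.exp (-x + -(ε * x)) := (Real.exp_add _ _).symm
      _ ≤ Real.exp (-q) := Real.exp_le_exp.2 (by linarith)
  have h2 : Real.exp (-x) * x ≤ 1 := by
    have := Real.add_one_le_exp x
    rw [Real.exp_neg, inv_mul_le_iff₀ (Real.exp_pos x)]
    linarith
  nlinarith

/-- If the loss is at most `1 + ε`, the model distribution function at `Y_{(k)}` differs from
`G(X_{(k)})` by at most `ε`. -/
lemma abs_sub_le_of_nseLoss_le {n : ℕ} {Λ : Finset (Fin n)} {F : ℝ → ℝ} {x y : Fin n → ℝ}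
    {ε : ℝ} (hε : 0 ≤ ε)
    (h : nseLoss Λ F x y ≤ ENNReal.ofReal (1 + ε)) {k : Fin n} (hk : k ∈ Λ)
    (hx : 0 < orderStat x k) :
    |F (orderStat y k) - (1 - Real.exp (-orderStat x k))| ≤ ε := by
  obtain ⟨⟨h1, h2⟩, -⟩ := gMax_le_iff.1 h
  have hxq := maxQuotient_le_iff.1 h1 k hk
  have hqx := maxQuotient_le_iff.1 h2 k hk
  have hx' : ENNReal.ofReal (orderStat x k) ≠ 0 := (ENNReal.ofReal_pos.2 hx).ne'
  -- A value ≥ 1 gives the quantile ∞, and q ≤ 0 below gives the quantile 0; either makes one of the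
  -- quotients infinite.
  have hlt : F (orderStat y k) < 1 := by
    by_contra hge
    simp only [expQuantile, if_neg hge] at hqx
    rw [ENNReal.top_div_of_ne_top ENNReal.ofReal_ne_top] at hqx
    exact absurd hqx (by simp)
  set q := -Real.log (1 - F (orderStat y k)) with hq
  simp only [expQuantile, if_pos hlt, ← hq] at hxq hqx
  have hFq : F (orderStat y k) = 1 - Real.exp (-q) := by
    rw [hq, neg_neg, Real.exp_log (by linarith)]
    ring
  have hq0 : 0 < q := by
    by_contra hq0
    rw [ENNReal.ofReal_of_nonpos (not_lt.1 hq0), ENNReal.div_zero hx'] at hxq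
    exact absurd hxq (by simp)
  rw [← ENNReal.ofReal_div_of_pos hq0, ENNReal.ofReal_le_ofReal_iff (by linarith),
    div_le_iff₀ hq0] at hxq
  rw [← ENNReal.ofReal_div_of_pos hx, ENNReal.ofReal_le_ofReal_iff (by linarith),
    div_le_iff₀ hx] at hqx
  have e1 := exp_neg_sub_exp_neg_le hε hqx
  have e2 := exp_neg_sub_exp_neg_le hε hxq
  rw [hFq, abs_le]
  constructor <;> linarith

/-! ### From the middle order statistics to the whole line -/

lemma mem_middleIndices {n : ℕ} {a b : ℝ} {k : Fin n} :
    k ∈ middleIndices n a b ↔ a * n < (k : ℝ) + 1 ∧ (k : ℝ) + 1 < b * n := by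
  simp [middleIndices]

lemma exists_mem_middleIndices_gt {n : ℕ} (hn : 0 < n) {a b s : ℝ} (ha : 0 ≤ a) (hb : b ≤ 1)
    (hs : 0 ≤ s) (hsb : s + a + 1 / n < b) :
    ∃ k ∈ middleIndices n a b, s < ((k : ℝ) + 1) / n ∧ ((k : ℝ) + 1) / n ≤ s + a + 1 / n := by
  have hn' : (0 : ℝ) < n := by exact_mod_cast hn
  -- `m` is the zero-based index: its rank m + 1 is the first integer strictly above both a·n and
  -- s·n.
  set m := ⌊max a s * n⌋₊ with hm
  have h0 : 0 ≤ max a s * n := by positivity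
  have h1 : (m : ℝ) ≤ max a s * n := Nat.floor_le h0
  have h2 : max a s * n < m + 1 := Nat.lt_floor_add_one _
  have h3 : max a s ≤ s + a := max_le (by linarith) (by linarith)
  have h4 : ((m : ℝ) + 1) / n ≤ s + a + 1 / n := by
    rw [div_le_iff₀ hn', add_mul, one_div_mul_cancel hn'.ne']
    nlinarith
  have h5 : (m : ℝ) + 1 < b * n := (div_lt_iff₀ hn').1 (h4.trans_lt hsb)
  have h6 : m < n := by
    have : (m : ℝ) < n := by nlinarith
    exact_mod_cast this
  have h7 : a * n ≤ max a s * n := by gcongr; exact le_max_left _ _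
  have h8 : s * n ≤ max a s * n := by gcongr; exact le_max_right _ _
  refine ⟨⟨m, h6⟩, mem_middleIndices.2 ⟨?_, h5⟩, ?_, h4⟩
  · exact h7.trans_lt h2
  · rw [lt_div_iff₀ hn']
    exact h8.trans_lt h2

lemma exists_mem_middleIndices_lt {n : ℕ} (hn : 0 < n) {a b s : ℝ} (ha : 0 ≤ a) (hb : b ≤ 1)
    (hs : s ≤ 1) (hsa : a < s - (1 - b) - 1 / n) :
    ∃ k ∈ middleIndices n a b,
      ((k : ℝ) + 1) / n < s ∧ s - (1 - b) - 1 / n ≤ ((k : ℝ) + 1) / n := by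
  have hn' : (0 : ℝ) < n := by exact_mod_cast hn
  have hinv : 0 < 1 / (n : ℝ) := by positivity
  -- The rank is m - 1, the last integer strictly below both b·n and s·n, hence the zero-based index
  -- m - 2.
  set m := ⌈min b s * n⌉₊ with hm
  have h3 : s - (1 - b) ≤ min b s := le_min (by linarith) (by linarith)
  have h1 : min b s * n ≤ m := Nat.le_ceil _
  have h0 : 0 ≤ min b s * n := mul_nonneg (by linarith) hn'.le
  have h2 : (m : ℝ) < min b s * n + 1 := Nat.ceil_lt_add_one h0
  have hlow : (s - (1 - b) - 1 / n) * n ≤ m - 1 := by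
    rw [sub_mul _ (1 / (n : ℝ)), one_div_mul_cancel hn'.ne']
    nlinarith
  have hpos : (0 : ℝ) < m - 1 := lt_of_lt_of_le (mul_pos (by linarith) hn') hlow
  have hm2 : 2 ≤ m := by
    have : (1 : ℝ) < m := by linarith
    exact_mod_cast this
  have hbn : min b s * n ≤ b * n := by gcongr; exact min_le_left _ _
  have hsn : min b s * n ≤ s * n := by gcongr; exact min_le_right _ _
  have hmn : m - 2 < n := by
    have : (m : ℝ) < n + 1 := by nlinarith
    have : m < n + 1 := by exact_mod_cast this
    omega
  have hcast : (((m - 2 : ℕ) : ℝ)) + 1 = m - 1 := by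
    push_cast [Nat.cast_sub hm2]
    ring
  refine ⟨⟨m - 2, hmn⟩, mem_middleIndices.2 ⟨?_, ?_⟩, ?_, ?_⟩
  · simp only [hcast]
    exact lt_of_lt_of_le (mul_lt_mul_of_pos_right hsa hn') hlow
  · simp only [hcast]
    linarith
  · simp only [hcast]
    rw [div_lt_iff₀ hn']
    linarith
  · simp only [hcast]
    rwa [le_div_iff₀ hn']

/-- Compare z with a `y k` on the proper side whose rank is nearest to n·H(z). Truncation loses a or
1 - b, the grid 1/n, and the two approximations 2δ + ε. In the extreme tails the bound follows from
0 ≤ F ≤ 1. -/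
lemma abs_sub_le_of_middleIndices {n : ℕ} (hn : 0 < n) {a b δ ε η : ℝ} (ha : 0 ≤ a) (hb : b ≤ 1)
    (hδ : 0 ≤ δ) (hε : 0 ≤ ε) (hη : a + (1 - b) + 2 * δ + 1 / n + ε < η) {F H : ℝ → ℝ}
    (hF : Monotone F) (hH : Monotone H) (hF01 : ∀ z, F z ∈ Set.Icc (0 : ℝ) 1)
    (hH01 : ∀ z, H z ∈ Set.Icc (0 : ℝ) 1) {y : Fin n → ℝ}
    (hyH : ∀ k ∈ middleIndices n a b, |H (y k) - ((k : ℝ) + 1) / n| ≤ δ)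
    (hyF : ∀ k ∈ middleIndices n a b, |F (y k) - ((k : ℝ) + 1) / n| ≤ ε + δ) (z : ℝ) :
    |F z - H z| ≤ η := by
  obtain ⟨hF0, hF1⟩ := hF01 z
  obtain ⟨hH0, hH1⟩ := hH01 z
  have hinv : 0 ≤ 1 / (n : ℝ) := by positivity
  rw [abs_le]
  constructor
  · rcases le_or_gt (H z) η with h | h
    · linarith
    -- The shift by δ ensures H(y k) < H(z), hence y k < z.
    obtain ⟨k, hk, h1, h2⟩ := exists_mem_middleIndices_lt hn ha hb (s := H z - δ)
      (by linarith) (by linarith)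
    have hyk := abs_le.1 (hyH k hk)
    have hFk := abs_le.1 (hyF k hk)
    have hlt : y k < z := hH.reflect_lt (by linarith)
    have := hF hlt.le
    linarith
  · rcases le_or_gt (1 - η) (H z) with h | h
    · linarith
    obtain ⟨k, hk, h1, h2⟩ := exists_mem_middleIndices_gt hn ha hb (s := H z + δ)
      (by linarith) (by linarith)
    have hyk := abs_le.1 (hyH k hk)
    have hFk := abs_le.1 (hyF k hk)
    have hlt : z < y k := hH.reflect_lt (by linarith)
    have := hF hlt.le
    linarith

/-! ### The estimator on the event where both samples are regular -/

section Estimator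

variable {n : ℕ} {a b δ ε : ℝ} {x y : Fin n → ℝ}

lemma nseLoss_cdf_le (ν : Measure ℝ) (hn : 0 < n)
    (hΛ : (middleIndices n a b).Nonempty) (hδ : δ ≤ 1 / 4) (hε : 0 < ε)
    (ha : δ < a) (hb : δ < 1 - b) (haε : 8 * δ ≤ ε * (a - δ)) (hbε : 8 * δ ≤ ε * (1 - b - δ))
    (hx : ∀ k ∈ middleIndices n a b,
      |cdf (expMeasure 1) (orderStat x k) - ((k : ℝ) + 1) / n| ≤ δ)
    (hy : ∀ k ∈ middleIndices n a b, |cdf ν (orderStat y k) - ((k : ℝ) + 1) / n| ≤ δ) :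
    nseLoss (middleIndices n a b) (cdf ν) x y ≤ ENNReal.ofReal (1 + ε) := by
  have hn' : (0 : ℝ) < n := by exact_mod_cast hn
  refine nseLoss_le hΛ fun k hk => ?_
  obtain ⟨hk1, hk2⟩ := mem_middleIndices.1 hk
  rw [← lt_div_iff₀ hn'] at hk1
  rw [← div_lt_iff₀ hn'] at hk2
  have hu := abs_le.1 (hx k hk)
  have hv := abs_le.1 (hy k hk)
  obtain ⟨hxpos, hxlog⟩ := eq_neg_log_of_cdf_expMeasure_pos (x := orderStat x k) (by linarith)
  -- With D this minimum, both distribution function values lie in [D, 1 - D], so the logarithmic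
  -- comparison applies in both directions.
  have hD : 0 < min (a - δ) (1 - b - δ) := lt_min (by linarith) (by linarith)
  have hDε : 8 * δ ≤ ε * min (a - δ) (1 - b - δ) := by
    rcases min_choice (a - δ) (1 - b - δ) with h | h <;> rw [h] <;> assumption
  have hDa := min_le_left (a - δ) (1 - b - δ)
  have hDb := min_le_right (a - δ) (1 - b - δ)
  refine ⟨-Real.log (1 - cdf ν (orderStat y k)), ?_, hxpos, if_pos (by linarith), ?_, ?_⟩
  · have := Real.log_neg (x := 1 - cdf ν (orderStat y k)) (by linarith) (by linarith)
    linarith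
  · nth_rewrite 1 [hxlog]
    exact neg_log_one_sub_le hD hε hδ hDε (by linarith) (by linarith) (by linarith)
      (by linarith)
  · nth_rewrite 1 [hxlog]
    exact neg_log_one_sub_le hD hε hδ hDε (by linarith) (by linarith) (by linarith)
      (by linarith)

lemma abs_cdf_sub_le_of_isNSE {Θ : Type*} {P : Θ → Measure ℝ} {θ₀ t : Θ} {η : ℝ} (hn : 0 < n)
    (hδ0 : 0 ≤ δ) (hδ : δ ≤ 1 / 4) (hε : 0 < ε)
    (ha : δ < a) (hb : δ < 1 - b) (haε : 8 * δ ≤ ε * (a - δ)) (hbε : 8 * δ ≤ ε * (1 - b - δ))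
    (hab : a + (1 - b) + 2 * δ + 1 / n + ε < min η 1)
    (hx : ∀ k ∈ middleIndices n a b,
      |cdf (expMeasure 1) (orderStat x k) - ((k : ℝ) + 1) / n| ≤ δ)
    (hy : ∀ k ∈ middleIndices n a b, |cdf (P θ₀) (orderStat y k) - ((k : ℝ) + 1) / n| ≤ δ)
    (ht : IsNSE P (middleIndices n a b) x y t) (z : ℝ) :
    |cdf (P t) z - cdf (P θ₀) z| ≤ η := by
  have hn' : (0 : ℝ) < n := by exact_mod_cast hn
  have hη := hab.trans_le (min_le_left _ _)
  -- The bound by 1 yields a + 1/n < b, so some integer rank lies in the middle range.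
  have h1 := hab.trans_le (min_le_right _ _)
  have hΛ : (middleIndices n a b).Nonempty := by
    obtain ⟨k, hk, -⟩ := exists_mem_middleIndices_gt hn (a := a) (b := b) (s := 0) (by linarith)
      (by linarith) le_rfl (by linarith)
    exact ⟨k, hk⟩
  have hloss := (ht θ₀).trans (nseLoss_cdf_le (P θ₀) hn hΛ hδ hε ha hb haε hbε hx hy)
  refine abs_sub_le_of_middleIndices hn (by linarith) (by linarith) hδ0 hε.le hη
    (monotone_cdf _) (monotone_cdf _) (fun z => ⟨cdf_nonneg _ z, cdf_le_one _ z⟩)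
    (fun z => ⟨cdf_nonneg _ z, cdf_le_one _ z⟩) hy (fun k hk => ?_) z
  have hk1 := (mem_middleIndices.1 hk).1
  rw [← lt_div_iff₀ hn'] at hk1
  have hu := hx k hk
  have hpos : 0 < orderStat x k :=
    (eq_neg_log_of_cdf_expMeasure_pos (by linarith [(abs_le.1 hu).1])).1
  have hcl := abs_sub_le_of_nseLoss_le hε.le hloss hk hpos
  rw [cdf_expMeasure_one, if_pos hpos.le] at hu
  exact (abs_sub_le _ _ _).trans (add_le_add hcl hu)

end Estimator

/-- Identifiability gives a uniform modulus: distribution functions uniformly close to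
`F(·, θ₀)` come from parameters close to `θ₀`. -/
lemma IdentifiableAt.exists_forall_dist_lt {Θ : Type*} [PseudoMetricSpace Θ] {P : Θ → Measure ℝ}
    {θ₀ : Θ} (h : IdentifiableAt P θ₀) {r : ℝ} (hr : 0 < r) :
    ∃ η > 0, ∀ t : Θ, (∀ z, |cdf (P t) z - cdf (P θ₀) z| ≤ η) → dist t θ₀ < r := by
  by_contra! hcon
  choose t ht hdist using fun j : ℕ => hcon (1 / ((j : ℝ) + 1)) (by positivity)
  have hlim : Tendsto t atTop (𝓝 θ₀) := h t fun z => by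
    rw [tendsto_iff_dist_tendsto_zero]
    exact squeeze_zero (fun _ => dist_nonneg) (fun j => ht j z)
      tendsto_one_div_add_atTop_nhds_zero_nat
  obtain ⟨j, hj⟩ := (hlim.eventually (Metric.ball_mem_nhds θ₀ hr)).exists
  exact absurd hj (not_lt.2 (hdist j))

/-! ### Asymptotics of the truncation levels -/

lemma tendsto_sqrt_log_div_self :
    Tendsto (fun n : ℕ => Real.sqrt (Real.log n / n)) atTop (𝓝 0) := by
  have h : Tendsto (fun n : ℕ => Real.log n / n) atTop (𝓝 0) :=
    (Real.isLittleO_log_id_atTop.tendsto_div_nhds_zero).comp tendsto_natCast_atTop_atTop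
  simpa using h.sqrt

/-- This fixes the radius √(log n / n): the Hoeffding tail is then of order n⁻², which survives a
union over n indices. -/
lemma mul_exp_neg_two_mul_sqrt_log_div_self {n : ℕ} (hn : 0 < n) :
    (n : ℝ) * (2 * Real.exp (-2 * n * Real.sqrt (Real.log n / n) ^ 2)) = 2 / n := by
  have hn' : (0 : ℝ) < n := by exact_mod_cast hn
  have hlog : 0 ≤ Real.log n := Real.log_natCast_nonneg n
  rw [Real.sq_sqrt (by positivity)]
  have : -2 * (n : ℝ) * (Real.log n / n) = -(Real.log n + Real.log n) := by
    field_simp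
    ring
  rw [this, Real.exp_neg, Real.exp_add, Real.exp_log hn']
  field_simp

lemma MiddleCondition.eventually_mul_le {α β : ℕ → ℝ} (h : MiddleCondition α β) (M : ℝ) :
    ∀ᶠ n : ℕ in atTop, 0 < Real.sqrt (Real.log n / n) ∧
      M * Real.sqrt (Real.log n / n) ≤ α n ∧ M * Real.sqrt (Real.log n / n) ≤ 1 - β n := by
  filter_upwards [h.2.eventually_ge_atTop M, eventually_ge_atTop 2] with n hM hn
  have hn' : (1 : ℝ) < n := by exact_mod_cast hn
  have hpos : 0 < Real.sqrt (Real.log n / n) :=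
    Real.sqrt_pos.2 (div_pos (Real.log_pos hn') (by linarith))
  rw [le_div_iff₀ hpos] at hM
  exact ⟨hpos, hM.trans (min_le_left _ _), hM.trans (min_le_right _ _)⟩

lemma tendsto_measure_irregular {Ω : Type*} [MeasurableSpace Ω] (μ : Measure Ω)
    [IsProbabilityMeasure μ] {ν : Measure ℝ} [IsProbabilityMeasure ν] (hc : Continuous (cdf ν))
    {α β : ℕ → ℝ} (hmid : MiddleCondition α β) {Z : (n : ℕ) → Fin n → Ω → ℝ}
    (hlaw : ∀ n i, HasLaw (Z n i) ν μ) (hind : ∀ n, iIndepFun (Z n) μ) :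
    Tendsto (fun n : ℕ => μ {ω | ∃ k ∈ middleIndices n (α n) (β n),
      Real.sqrt (Real.log n / n) < |cdf ν (orderStat (fun i => Z n i ω) k) - ((k : ℝ) + 1) / n|})
      atTop (𝓝 0) := by
  rw [← ENNReal.tendsto_toReal_zero_iff fun _ => measure_ne_top _ _]
  have hlim : Tendsto (fun n : ℕ => 2 / (n : ℝ)) atTop (𝓝 0) :=
    tendsto_const_nhds.div_atTop tendsto_natCast_atTop_atTop
  refine squeeze_zero' (Eventually.of_forall fun _ => ENNReal.toReal_nonneg) ?_ hlim
  -- Factor 1 is enough here: it keeps (k+1)/n ± δ inside (0, 1) for every middle index.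
  filter_upwards [hmid.eventually_mul_le 1, eventually_gt_atTop 0] with n ⟨hδ, hα, hβ⟩ hn
  have hn' : (0 : ℝ) < n := by exact_mod_cast hn
  rw [← mul_exp_neg_two_mul_sqrt_log_div_self hn]
  refine measureReal_exists_cdf_orderStat_le (hlaw n) (hind n) hc _ hδ.le fun k hk => ?_
  obtain ⟨hk1, hk2⟩ := mem_middleIndices.1 hk
  rw [← lt_div_iff₀ hn'] at hk1
  rw [← div_lt_iff₀ hn'] at hk2
  constructor <;> linarith

/-! ### Consistency of the minimizer -/

theorem proposition3
    {Ω : Type*} [MeasurableSpace Ω] (μ : Measure Ω) [IsProbabilityMeasure μ]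
    {p : ℕ} (Θ : Set (EuclideanSpace ℝ (Fin p)))
    (P : Θ → Measure ℝ) [∀ θ, IsProbabilityMeasure (P θ)]
    (θstar : Θ)
    (hcont : Continuous (cdf (P θstar)))
    (hident : IdentifiableAt P θstar)
    (α β : ℕ → ℝ) (hmid : MiddleCondition α β)
    (hα : Tendsto α atTop (𝓝 0)) (hβ : Tendsto β atTop (𝓝 1))
    (X Y : (n : ℕ) → Fin n → Ω → ℝ)
    (hXlaw : ∀ n i, HasLaw (X n i) (expMeasure 1) μ)
    (hXindep : ∀ n, iIndepFun (X n) μ)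
    (hYlaw : ∀ n i, HasLaw (Y n i) (P θstar) μ)
    (hYindep : ∀ n, iIndepFun (Y n) μ)
    (θhat : ℕ → Ω → Θ)
    (hθhat : Tendsto (fun n => μ {ω | ¬ IsNSE P (middleIndices n (α n) (β n))
      (fun i => X n i ω) (fun i => Y n i ω) (θhat n ω)}) atTop (𝓝 0)) :
    TendstoInMeasure μ θhat atTop (fun _ => θstar) := by
  rw [tendstoInMeasure_iff_dist]
  intro r hr
  obtain ⟨η, hη, hmod⟩ := hident.exists_forall_dist_lt hr
  have : IsProbabilityMeasure (expMeasure 1) := isProbabilityMeasure_expMeasure one_pos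
  have hX := tendsto_measure_irregular μ continuous_cdf_expMeasure_one hmid hXlaw hXindep
  have hY := tendsto_measure_irregular μ hcont hmid hYlaw hYindep
  have hsum := (hX.add hY).add hθhat
  simp only [add_zero] at hsum
  refine tendsto_of_tendsto_of_tendsto_of_le_of_le' tendsto_const_nhds hsum
    (Eventually.of_forall fun _ => zero_le) ?_
  have hη1 : 0 < min η 1 := lt_min hη one_pos
  -- Half of the allowance is kept for the terms that vanish as n grows.
  set ε := min η 1 / 2 with hεdef
  have hε : 0 < ε := by positivity
  have hδlim := tendsto_sqrt_log_div_self
  have hsmall : ∀ᶠ n : ℕ in atTop,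
      α n + (1 - β n) + 2 * Real.sqrt (Real.log n / n) + 1 / n + ε < min η 1 := by
    have h : Tendsto (fun n : ℕ =>
        α n + (1 - β n) + 2 * Real.sqrt (Real.log n / n) + 1 / n + ε) atTop
        (𝓝 (0 + (1 - 1) + 2 * 0 + 0 + ε)) :=
      (((hα.add (hβ.const_sub 1)).add (hδlim.const_mul 2)).add
        tendsto_one_div_atTop_nhds_zero_nat).add_const ε
    exact h.eventually (gt_mem_nhds (by linarith))
  -- For c = α_n or 1 - β_n, the summand 8/ε gives 8δ ≤ ε(c - δ), and 2 covers the subtracted δ.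
  filter_upwards [hmid.eventually_mul_le (2 + 8 / ε), hsmall, eventually_gt_atTop 0,
    hδlim.eventually (gt_mem_nhds (show (0 : ℝ) < 1 / 4 by norm_num))]
    with n ⟨hδ, hαn, hβn⟩ hs hn hδ4
  have hmul : ∀ c, (2 + 8 / ε) * Real.sqrt (Real.log n / n) ≤ c →
      Real.sqrt (Real.log n / n) < c ∧
        8 * Real.sqrt (Real.log n / n) ≤ ε * (c - Real.sqrt (Real.log n / n)) := by
    intro c hc
    have hε8 : 0 < 8 / ε * Real.sqrt (Real.log n / n) := by positivity
    have he : ε * (8 / ε * Real.sqrt (Real.log n / n)) = 8 * Real.sqrt (Real.log n / n) := by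
      field_simp
    refine ⟨by linarith, ?_⟩
    rw [← he]
    exact mul_le_mul_of_nonneg_left (by linarith) hε.le
  refine (measure_mono ?_).trans ((measure_union_le _ _).trans
    (add_le_add_left (measure_union_le _ _) _))
  intro ω hω
  by_contra hgood
  simp only [Set.mem_union, Set.mem_ofPred_eq, not_or, not_exists, not_and, not_lt, not_not]
    at hgood
  obtain ⟨⟨hx, hy⟩, hnse⟩ := hgood
  refine absurd (hmod (θhat n ω) fun z => ?_) (not_lt.2 hω)
  exact abs_cdf_sub_le_of_isNSE hn hδ.le hδ4.le hε (hmul _ hαn).1 (hmul _ hβn).1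
    (hmul _ hαn).2 (hmul _ hβn).2 hs hx hy hnse z
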